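/- Let $(G_\sigma)_{\sigma\ge 1}$ be a family of probability measures on $[0,1]$ such that the product of independent random variables with laws $G_\sigma$ and $G_\tau$ has law $G_{\sigma\tau}$ for all $\sigma,\tau\ge1$ (a log-convolution semi-group), and such that $\int \sqrt r\,G_\sigma(dr)=1/\sigma$. Put $\gamma(\sigma)=G_\sigma(\{1\})$. Let $\phi(m,v,\cdot)$ be the density of the Gaussian law $N(m,v)$, let $P_{0,t}(x,\cdot)=N(x,t)$, and for $0<s<t$ and $\sigma=\sqrt{t/s}$ let $$P_{s,t}(x,dy)=\gamma(\sigma)\,\varepsilon_{\sigma x}(dy)+\Big(\int_{[0,1)}\phi\big(\sigma\sqrt r\,x,\;t(1-r),\;y\big)\,G_\sigma(dr)\Big)dy ,$$ where $\varepsilon_a$ is the Dirac measure at $a$. On a probability space with a filtration $(\mathcal F_t)_{t\ge0}$, let $(X_t)_{t\ge0}$ be an adapted Markov process started at $0$ with transition probabilities $P_{s,t}$ and with almost surely càdlàg paths. For $s>0$ let $T_s=\inf\{u>s: X_u\ne X_{u-}\}\in[s,\infty]$ (with $\inf\emptyset=\infty$) be the first jump time after $s$. (1) If $\gamma(\sigma)>0$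 for all $\sigma\ge1$, then $T_s$ is a random variable (up to null sets), and for all $t>s>0$ $$\mathbb P[T_s>t]=\gamma\big(\sqrt{t/s}\big).$$ (2) (Poisson case.) Let $c=1/(1-e^{-1/2})$ and let $G_\sigma$ be the law of $e^{-N_\sigma}$, where $N_\sigma$ is Poisson distributed with mean $c\ln\sigma$. This family satisfies the assumptions above with $\gamma(\sigma)=\sigma^{-c}$, and for the corresponding process, for all $t>s>0$, $$\mathbb P[T_s>t]=\frac{s^{c/2}}{t^{c/2}},$$ that is, $T_s$ has the Pareto law on $[s,\infty)$ with density $\frac c2\,s^{c/2}x^{-c/2-1}$. In particular $\mathbb E[T_s]=\dfrac{cs}{c-2}$ and $\mathbb E[T_s^2]=\infty$. -/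

import Mathlib

open MeasureTheory ProbabilityTheory Filter Topology Set
open scoped NNReal ENNReal

noncomputable section

namespace GaussianMarginals

/-- A log-convolution semi-group `(G_σ)_{σ ≥ 1}` of probability laws on `[0,1]` (the law of the
product of independent variables with laws `G_σ`, `G_τ` is `G_{στ}`), normalised so that the moment
of order `1/2` of `G_σ` is `1/σ`. Values of `G` at `σ < 1` are irrelevant. -/
structure IsLogConvSemigroup (G : ℝ → Measure ℝ) : Prop where
  isProbabilityMeasure : ∀ σ, 1 ≤ σ → IsProbabilityMeasure (G σ)
  supported : ∀ σ, 1 ≤ σ → ∀ᵐ r ∂(G σ), r ∈ Icc (0 : ℝ) 1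
  mconv_eq : ∀ σ τ, 1 ≤ σ → 1 ≤ τ → Measure.mconv (G σ) (G τ) = G (σ * τ)
  half_moment : ∀ σ, 1 ≤ σ → ∫ r, √r ∂(G σ) = 1 / σ

/-- `γ(σ) = G_σ({1})`. -/
def gam (G : ℝ → Measure ℝ) (σ : ℝ) : ℝ≥0∞ := G σ {1}

/-- The transition probabilities `P_{s,t}(x, dy)` for `0 ≤ s < t`. For `s = 0` this is the Gaussian
law `N(x, t)`; for `s > 0` and `σ = √(t/s)` it is
`γ(σ) ε_{σx}(dy) + (∫_{[0,1)} φ(σ √r x, t(1-r), y) G_σ(dr)) dy`,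
with `φ(m, v, ·)` the density of `N(m, v)`. -/
def transition (G : ℝ → Measure ℝ) (s t : ℝ≥0) (x : ℝ) : Measure ℝ :=
  if s = 0 then gaussianReal x t
  else
    gam G √((t : ℝ) / s) • Measure.dirac (√((t : ℝ) / s) * x) +
      volume.withDensity (fun y ↦ ∫⁻ r in Ico (0 : ℝ) 1,
        gaussianPDF (√((t : ℝ) / s) * √r * x) (Real.toNNReal (t * (1 - r))) y
          ∂(G √((t : ℝ) / s)))

/-- A path is càdlàg: right-continuous with finite left limits. -/
def IsCadlag (x : ℝ≥0 → ℝ) : Prop :=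
  ∀ t, ContinuousWithinAt x (Ici t) t ∧ ∃ l, Tendsto x (𝓝[<] t) (𝓝 l)

/-- The path `x` jumps at time `t`: its left limit `x_{t-}` exists and differs from `x_t`. -/
def JumpsAt (x : ℝ≥0 → ℝ) (t : ℝ≥0) : Prop :=
  ∃ l, Tendsto x (𝓝[<] t) (𝓝 l) ∧ l ≠ x t

/-- The first jump time of the path `x` after time `s`, equal to `∞` if there is no jump. -/
def firstJumpTime (x : ℝ≥0 → ℝ) (s : ℝ≥0) : ℝ≥0∞ :=
  sInf {u : ℝ≥0∞ | ∃ v : ℝ≥0, s < v ∧ JumpsAt x v ∧ u = v}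

/-- `X` is, with respect to the filtration `ℱ`, a Markov process started at `0` with transition
probabilities `P_{s,t}` built from `G`, with almost all paths càdlàg. -/
structure IsProcess {Ω : Type*} {mΩ : MeasurableSpace Ω} (μ : Measure Ω)
    (ℱ : Filtration ℝ≥0 mΩ) (G : ℝ → Measure ℝ) (X : ℝ≥0 → Ω → ℝ) : Prop where
  adapted : Adapted ℱ X
  start : ∀ᵐ ω ∂μ, X 0 ω = 0
  markov : ∀ s t : ℝ≥0, s < t → ∀ A : Set ℝ, MeasurableSet A →
    μ⟦X t ⁻¹' A | ℱ s⟧ =ᵐ[μ] fun ω ↦ (transition G s t (X s ω)).real A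
  cadlag : ∀ᵐ ω ∂μ, IsCadlag (fun t ↦ X t ω)

/-- The constant `c = 1 / (1 - e^{-1/2})` of the Poisson case. -/
def poissonConst : ℝ := 1 / (1 - Real.exp (-1 / 2))

/-- The Poisson case: `G_σ` is the law of `e^{-N}` with `N` Poisson of mean `c ln σ`. -/
def poissonFamily (σ : ℝ) : Measure ℝ :=
  (poissonMeasure (Real.toNNReal (poissonConst * Real.log σ))).map
    (fun n : ℕ ↦ Real.exp (-(n : ℝ)))

end GaussianMarginals

end

/-! Two independent factors in `[0,1]` have product 1 only if both are 1, so γ is multiplicative.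
Given `X s`, the ray event `X t = √(t/s) * X s` has probability γ(√(t/s)), since the rest of the
transition law has a density. The theorem follows once `T_s > t` is compared with this event.

From ray to no jump: for s < u < t, lying on the ray at u and continuing along it up to t has
probability γγ = γ, the same as being on the ray at t. Hence almost surely a path on the ray at t
was on it at all rational-like times before, and by right-continuity throughout (s, t), where it
cannot jump (`ae_le_firstJumpTime_of_mem_onRay`).

From no jump to ray: a path continuous on [s, t] has uniformly small deviations from the rays over a
fine geometric partition. If it is off the ray at t, some step is near its ray without being on it.
The union bound gives n small-ball integrals against the law of one step; `nsmul_setLIntegral_le`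
dominates their sum, after multiplication by γ(√(t/s)), by a single integral against the law of the
whole interval. This bound does not depend on n and vanishes with the deviation
(`ae_mem_onRay_of_lt_firstJumpTime`).

The remaining gap between `T_s ≥ t` and `T_s > t` closes because γ tends to 1 along roots of a fixed
ratio. The Poisson case is then a tail and moment computation. -/

namespace GaussianMarginals

/-! ### The atom at 1 of a log-convolution semi-group -/

section Semigroup

variable {G : ℝ → Measure ℝ}

lemma IsLogConvSemigroup.apply_mul (hG : IsLogConvSemigroup G) {σ τ : ℝ} (hσ : 1 ≤ σ)
    (hτ : 1 ≤ τ) {B : Set ℝ} (hB : MeasurableSet B) :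
    G (σ * τ) B = ((G σ).prod (G τ)) {p | p.1 * p.2 ∈ B} := by
  rw [← hG.mconv_eq σ τ hσ hτ, Measure.mconv, Measure.map_apply (by fun_prop) hB]
  rfl

lemma IsLogConvSemigroup.gam_le_one (hG : IsLogConvSemigroup G) {σ : ℝ} (hσ : 1 ≤ σ) :
    gam G σ ≤ 1 := by
  have := hG.isProbabilityMeasure σ hσ
  exact prob_le_one

lemma IsLogConvSemigroup.gam_mul (hG : IsLogConvSemigroup G) {σ τ : ℝ} (hσ : 1 ≤ σ)
    (hτ : 1 ≤ τ) : gam G (σ * τ) = gam G σ * gam G τ := by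
  have := hG.isProbabilityMeasure σ hσ
  have := hG.isProbabilityMeasure τ hτ
  unfold gam
  rw [hG.apply_mul hσ hτ (measurableSet_singleton _), ← Measure.prod_prod]
  refine measure_congr ?_
  have h1 := Measure.quasiMeasurePreserving_fst (μ := G σ) (ν := G τ) |>.ae (hG.supported σ hσ)
  have h2 := Measure.quasiMeasurePreserving_snd (μ := G σ) (ν := G τ) |>.ae (hG.supported τ hτ)
  filter_upwards [h1, h2] with p hp1 hp2
  refine propext ?_
  change p.1 * p.2 = 1 ↔ p.1 = 1 ∧ p.2 = 1
  constructor
  · intro h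
    have h3 := hp1.1; have h4 := hp1.2; have h5 := hp2.1; have h6 := hp2.2
    constructor <;> nlinarith
  · rintro ⟨h, h'⟩
    rw [h, h', one_mul]

lemma IsLogConvSemigroup.gam_one (hG : IsLogConvSemigroup G) (hpos : 0 < gam G 1) :
    gam G 1 = 1 := by
  have h := hG.gam_mul le_rfl le_rfl
  rw [mul_one] at h
  have hne : gam G 1 ≠ ∞ := ((hG.gam_le_one le_rfl).trans_lt ENNReal.one_lt_top).ne
  exact (ENNReal.mul_eq_left hpos.ne' hne).mp h.symm

lemma IsLogConvSemigroup.gam_pow (hG : IsLogConvSemigroup G) (hpos : 0 < gam G 1) {τ : ℝ}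
    (hτ : 1 ≤ τ) (n : ℕ) : gam G (τ ^ n) = gam G τ ^ n := by
  induction n with
  | zero => simpa using hG.gam_one hpos
  | succ n ih => rw [pow_succ, pow_succ, hG.gam_mul (one_le_pow₀ hτ) hτ, ih]

/-- A product lies in `B` whenever one factor is 1 and the other lies in `B`; the two cases are
disjoint because `1 ∉ B`. -/
lemma IsLogConvSemigroup.le_apply_mul (hG : IsLogConvSemigroup G) {σ τ : ℝ} (hσ : 1 ≤ σ)
    (hτ : 1 ≤ τ) {B : Set ℝ} (hB : MeasurableSet B) (h1 : (1 : ℝ) ∉ B) :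
    gam G τ * G σ B + gam G σ * G τ B ≤ G (σ * τ) B := by
  have := hG.isProbabilityMeasure σ hσ
  have := hG.isProbabilityMeasure τ hτ
  rw [hG.apply_mul hσ hτ hB, gam, gam, mul_comm (G τ {1}), ← Measure.prod_prod,
    ← Measure.prod_prod, ← measure_union]
  · refine measure_mono ?_
    rintro ⟨a, b⟩ (⟨ha, hb⟩ | ⟨ha, hb⟩)
    · have hb' : b = 1 := hb
      simpa [hb'] using ha
    · have ha' : a = 1 := ha
      simpa [ha'] using hb
  · rw [Set.disjoint_left]
    rintro ⟨a, b⟩ ⟨ha, -⟩ ⟨ha', -⟩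
    have h : a = 1 := ha'
    exact h1 (h ▸ ha)
  · exact (measurableSet_singleton _).prod hB

/-- Among n independent factors, exactly one lies in `B` and all others equal 1. This is what
absorbs the factor n of a union bound over n steps. -/
lemma IsLogConvSemigroup.nsmul_le_apply_pow (hG : IsLogConvSemigroup G) {τ : ℝ} (hτ : 1 ≤ τ)
    {B : Set ℝ} (hB : MeasurableSet B) (h1 : (1 : ℝ) ∉ B) (n : ℕ) :
    n * gam G (τ ^ n) * G τ B ≤ G (τ ^ n) B := by
  induction n with
  | zero => simp
  | succ n ih =>
    have hn : 1 ≤ τ ^ n := one_le_pow₀ hτ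
    calc ((n + 1 : ℕ) : ℝ≥0∞) * gam G (τ ^ (n + 1)) * G τ B
        = gam G τ * (n * gam G (τ ^ n) * G τ B) + gam G (τ ^ n) * (gam G τ * G τ B) := by
          rw [pow_succ, hG.gam_mul hn hτ]; push_cast; ring
      _ ≤ gam G τ * G (τ ^ n) B + gam G (τ ^ n) * (1 * G τ B) := by
          gcongr
          exact hG.gam_le_one hτ
      _ ≤ G (τ ^ (n + 1)) B := by
          rw [one_mul, pow_succ]
          exact hG.le_apply_mul hn hτ hB h1

lemma IsLogConvSemigroup.nsmul_setLIntegral_le (hG : IsLogConvSemigroup G) {τ : ℝ} (hτ : 1 ≤ τ)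
    (n : ℕ) (f : ℝ → ℝ≥0∞) :
    n * gam G (τ ^ n) * ∫⁻ r in Ico (0 : ℝ) 1, f r ∂(G τ) ≤
      ∫⁻ r in Ico (0 : ℝ) 1, f r ∂(G (τ ^ n)) := by
  rw [← smul_eq_mul, ← lintegral_smul_measure]
  refine lintegral_mono' (Measure.le_iff.mpr fun B hB ↦ ?_) le_rfl
  rw [Measure.smul_apply, Measure.restrict_apply hB, Measure.restrict_apply hB, smul_eq_mul]
  exact hG.nsmul_le_apply_pow hτ (hB.inter measurableSet_Ico) (fun h ↦ lt_irrefl _ h.2.2) n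

lemma IsLogConvSemigroup.gam_add_apply_Ico (hG : IsLogConvSemigroup G) {σ : ℝ} (hσ : 1 ≤ σ) :
    gam G σ + G σ (Ico 0 1) = 1 := by
  have := hG.isProbabilityMeasure σ hσ
  have h : G σ (Icc 0 1) = 1 := by
    rw [prob_compl_eq_zero_iff measurableSet_Icc |>.symm]
    exact hG.supported σ hσ
  rw [gam, add_comm, ← measure_union (by simp) (measurableSet_singleton _),
    Ico_union_right zero_le_one, h]

end Semigroup

/-! ### Small-ball estimate for Gaussian laws -/

section Gaussian

lemma measurable_gaussianPDF_comp {α : Type*} [MeasurableSpace α] {m : α → ℝ} {v : α → ℝ≥0}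
    {y : α → ℝ} (hm : Measurable m) (hv : Measurable v) (hy : Measurable y) :
    Measurable fun a ↦ gaussianPDF (m a) (v a) (y a) := by
  unfold gaussianPDF gaussianPDFReal
  fun_prop

/-- The density is at most `1 / √(2πv) ≤ 1 / √v`, and the ball has length `2 * δ`. -/
lemma gaussianReal_closedBall_le (m : ℝ) {v : ℝ≥0} (hv : v ≠ 0) (a δ : ℝ) :
    gaussianReal m v (Metric.closedBall a δ) ≤ ENNReal.ofReal (2 * δ / √v) := by
  have hle : ∀ y, gaussianPDF m v y ≤ ENNReal.ofReal ((√v)⁻¹) := by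
    intro y
    refine ENNReal.ofReal_le_ofReal ?_
    have hv' : 0 < (v : ℝ) := by positivity
    have h1 : Real.exp (-(y - m) ^ 2 / (2 * v)) ≤ 1 := by
      rw [Real.exp_le_one_iff]
      apply div_nonpos_of_nonpos_of_nonneg
      · nlinarith [sq_nonneg (y - m)]
      · positivity
    have h2 : (√(2 * Real.pi * v))⁻¹ ≤ (√v)⁻¹ := by
      gcongr
      nlinarith [Real.pi_gt_three]
    calc _ ≤ (√v)⁻¹ * 1 := by unfold gaussianPDFReal; gcongr
      _ = _ := mul_one _
  rw [gaussianReal_apply m hv]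
  calc _ ≤ ∫⁻ _ in Metric.closedBall a δ, ENNReal.ofReal ((√v)⁻¹) := lintegral_mono hle
    _ = _ := by
      rw [setLIntegral_const, Real.volume_closedBall, ← ENNReal.ofReal_mul (by positivity)]
      congr 1
      ring

end Gaussian

/-! ### The transition kernel and its mass near the ray -/

section Transition

variable {G : ℝ → Measure ℝ} {s t : ℝ≥0}

lemma one_le_sqrt_div (hs : 0 < s) (hst : s ≤ t) : 1 ≤ √((t : ℝ) / s) := by
  rw [Real.one_le_sqrt, one_le_div (by positivity)]
  exact_mod_cast hst

lemma transition_apply (hG : IsLogConvSemigroup G) (hs : 0 < s) (hst : s < t) (x : ℝ)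
    {A : Set ℝ} (hA : MeasurableSet A) :
    transition G s t x A = gam G √((t : ℝ) / s) * A.indicator 1 (√((t : ℝ) / s) * x) +
      ∫⁻ r in Ico (0 : ℝ) 1, gaussianReal (√((t : ℝ) / s) * √r * x) (Real.toNNReal (t * (1 - r))) A
        ∂(G √((t : ℝ) / s)) := by
  have := hG.isProbabilityMeasure _ (one_le_sqrt_div hs hst.le)
  have ht : 0 < t := hs.trans hst
  rw [transition, if_neg hs.ne', Measure.add_apply, Measure.smul_apply, Measure.dirac_apply' _ hA,
    withDensity_apply _ hA, smul_eq_mul]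
  congr 1
  rw [lintegral_lintegral_swap]
  · refine setLIntegral_congr_fun measurableSet_Ico fun r hr ↦ ?_
    rw [gaussianReal_apply]
    have : 0 < (t : ℝ) * (1 - r) := mul_pos (by positivity) (by linarith [hr.2])
    simpa using this
  · exact (measurable_gaussianPDF_comp (by fun_prop) (by fun_prop) (by fun_prop)).aemeasurable

lemma isProbabilityMeasure_transition (hG : IsLogConvSemigroup G) (hs : 0 < s) (hst : s < t)
    (x : ℝ) : IsProbabilityMeasure (transition G s t x) := by
  constructor
  rw [transition_apply hG hs hst x .univ]
  simpa using hG.gam_add_apply_Ico (one_le_sqrt_div hs hst.le)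

lemma measurable_transition (hG : IsLogConvSemigroup G) (hs : 0 < s) (hst : s < t) :
    Measurable (transition G s t) := by
  have := hG.isProbabilityMeasure _ (one_le_sqrt_div hs hst.le)
  refine Measure.measurable_of_measurable_coe _ fun A hA ↦ ?_
  simp_rw [transition, if_neg hs.ne', Measure.add_apply, Measure.smul_apply,
    Measure.dirac_apply' _ hA, withDensity_apply _ hA, smul_eq_mul]
  refine Measurable.add (((measurable_one.indicator hA).comp (by fun_prop)).const_mul _) ?_
  refine Measurable.lintegral_prod_right' (f := fun p : ℝ × ℝ ↦ ∫⁻ r in Ico (0 : ℝ) 1,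
    gaussianPDF (√((t : ℝ) / s) * √r * p.1) (Real.toNNReal (t * (1 - r))) p.2
      ∂(G √((t : ℝ) / s))) ?_
  refine Measurable.lintegral_prod_right' (f := fun q : (ℝ × ℝ) × ℝ ↦
    gaussianPDF (√((t : ℝ) / s) * √q.2 * q.1.1) (Real.toNNReal (t * (1 - q.2))) q.1.2) ?_
  exact measurable_gaussianPDF_comp (by fun_prop) (by fun_prop) (by fun_prop)

/-- The transition probabilities as a Markov kernel. -/
noncomputable def transitionKernel (hG : IsLogConvSemigroup G) (hs : 0 < s) (hst : s < t) :
    Kernel ℝ ℝ :=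
  ⟨transition G s t, measurable_transition hG hs hst⟩

lemma transitionKernel_apply (hG : IsLogConvSemigroup G) (hs : 0 < s) (hst : s < t) (x : ℝ) :
    transitionKernel hG hs hst x = transition G s t x := rfl

instance (hG : IsLogConvSemigroup G) (hs : 0 < s) (hst : s < t) :
    IsMarkovKernel (transitionKernel hG hs hst) :=
  ⟨isProbabilityMeasure_transition hG hs hst⟩

lemma transition_apply_singleton (hs : 0 < s) (x : ℝ) :
    transition G s t x {√((t : ℝ) / s) * x} = gam G √((t : ℝ) / s) := by
  rw [transition, if_neg hs.ne']
  simp [withDensity_apply _ (measurableSet_singleton _)]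

/-- An upper bound for the probability that a Gaussian variable of variance at least
`s * (1 - r)` falls into a given interval of length `2 * δ`. -/
noncomputable def smallBallBound (s : ℝ≥0) (δ r : ℝ) : ℝ≥0∞ :=
  min 1 (ENNReal.ofReal (2 * δ / √(s * (1 - r))))

/-- Removing the centre removes the atom, leaving the Gaussian mixture. Replacing the variance
parameter `t` by a lower bound `u` makes the estimate uniform over the steps of a partition. -/
lemma transition_closedBall_diff_le (hG : IsLogConvSemigroup G) (hs : 0 < s) (hst : s < t)
    {u : ℝ≥0} (hu : 0 < u) (hut : u ≤ t) (x : ℝ) {δ : ℝ} (hδ : 0 ≤ δ) :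
    transition G s t x (Metric.closedBall (√((t : ℝ) / s) * x) δ \ {√((t : ℝ) / s) * x}) ≤
      ∫⁻ r in Ico (0 : ℝ) 1, smallBallBound u δ r ∂(G √((t : ℝ) / s)) := by
  rw [transition_apply hG hs hst x (measurableSet_closedBall.diff (measurableSet_singleton _))]
  simp only [Set.mem_sdiff, mem_singleton_iff, not_true_eq_false, and_false, not_false_eq_true,
    indicator_of_notMem, mul_zero, zero_add]
  refine setLIntegral_mono' measurableSet_Ico fun r hr ↦ le_min prob_le_one ?_
  have hr' : 0 < 1 - r := by linarith [hr.2]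
  have h0 : 0 < (t : ℝ) * (1 - r) := mul_pos (by exact_mod_cast hu.trans_le hut) hr'
  refine (measure_mono sdiff_subset).trans ((gaussianReal_closedBall_le _ ?_ _ _).trans ?_)
  · simpa using h0
  · rw [Real.coe_toNNReal _ h0.le]
    refine ENNReal.ofReal_le_ofReal ?_
    gcongr

lemma tendsto_lintegral_smallBallBound {σ : ℝ} (hG : IsLogConvSemigroup G) (hσ : 1 ≤ σ)
    (s : ℝ≥0) :
    Tendsto (fun δ ↦ ∫⁻ r in Ico (0 : ℝ) 1, smallBallBound s δ r ∂(G σ)) (𝓝[>] 0) (𝓝 0) := by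
  have := hG.isProbabilityMeasure σ hσ
  rw [← lintegral_zero (μ := (G σ).restrict (Ico 0 1))]
  -- The truncation at 1 supplies the dominating function; the untruncated bound is singular at `r =
  -- 1`.
  refine tendsto_lintegral_filter_of_dominated_convergence (fun _ ↦ 1) ?_ ?_ (by simp) ?_
  · refine .of_forall fun δ ↦ ?_
    unfold smallBallBound
    fun_prop
  · exact .of_forall fun δ ↦ .of_forall fun r ↦ min_le_left _ _
  · refine .of_forall fun r ↦ ?_
    have h : Tendsto (fun δ ↦ smallBallBound s δ r) (𝓝 0) (𝓝 (smallBallBound s 0 r)) := by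
      apply Continuous.tendsto
      unfold smallBallBound
      exact continuous_const.min (ENNReal.continuous_ofReal.comp (by fun_prop))
    simpa [smallBallBound] using h.mono_left nhdsWithin_le_nhds

end Transition

/-! ### Ray events under the Markov property -/

section Markov

variable {Ω : Type*} {mΩ : MeasurableSpace Ω} {μ : Measure Ω} {ℱ : Filtration ℝ≥0 mΩ}
  {G : ℝ → Measure ℝ} {X : ℝ≥0 → Ω → ℝ} {s t : ℝ≥0}

/-- The event that `X` lies at time `t` on the deterministic curve `u ↦ √(u / s) * X s`. -/
def onRay (X : ℝ≥0 → Ω → ℝ) (s t : ℝ≥0) : Set Ω := {ω | X t ω = √((t : ℝ) / s) * X s ω}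

lemma IsProcess.measurable (hX : IsProcess μ ℱ G X) (t : ℝ≥0) : Measurable (X t) :=
  (hX.adapted t).mono (ℱ.le t) le_rfl

lemma IsProcess.measurableSet_onRay_filtration (hX : IsProcess μ ℱ G X) (hst : s ≤ t) :
    MeasurableSet[ℱ t] (onRay X s t) := by
  have h1 : Measurable[ℱ t] (X t) := hX.adapted t
  have h2 : Measurable[ℱ t] (X s) := (hX.adapted s).mono (ℱ.mono hst) le_rfl
  exact measurableSet_eq_fun h1 (h2.const_mul _)

lemma IsProcess.measurableSet_onRay (hX : IsProcess μ ℱ G X) : MeasurableSet (onRay X s t) :=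
  measurableSet_eq_fun (hX.measurable t) ((hX.measurable s).const_mul _)

variable [IsProbabilityMeasure μ]

lemma IsProcess.setLIntegral_transition (hX : IsProcess μ ℱ G X) (hG : IsLogConvSemigroup G)
    (hs : 0 < s) (hst : s < t) {H : Set Ω} (hH : MeasurableSet[ℱ s] H) {A : Set ℝ}
    (hA : MeasurableSet A) :
    ∫⁻ ω in H, transition G s t (X s ω) A ∂μ = μ (X t ⁻¹' A ∩ H) := by
  have hprob := isProbabilityMeasure_transition hG hs hst
  have hH' : MeasurableSet H := ℱ.le s _ hH
  have htA : MeasurableSet (X t ⁻¹' A) := hX.measurable t hA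
  have h1 := setIntegral_condExp (μ := μ) (ℱ.le s)
    ((integrable_const (1 : ℝ)).indicator htA) hH
  have h2 : ∫ ω in H, (transition G s t (X s ω)).real A ∂μ =
      ∫ ω in H, (X t ⁻¹' A).indicator (fun _ ↦ (1 : ℝ)) ω ∂μ := by
    rw [← h1]
    exact setIntegral_congr_ae hH' ((hX.markov s t hst A hA).mono fun ω h _ ↦ h.symm)
  rw [integral_indicator_const _ htA, smul_eq_mul, mul_one, measureReal_restrict_apply htA,
    integral_eq_lintegral_of_nonneg_ae (.of_forall fun _ ↦ measureReal_nonneg)] at h2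
  · rw [← ENNReal.toReal_eq_toReal_iff' _ (measure_ne_top _ _)]
    · rw [← measureReal_def, ← h2]
      congr 1
      exact lintegral_congr fun ω ↦ (ofReal_measureReal).symm
    · refine ((lintegral_mono fun ω ↦ prob_le_one).trans_lt ?_).ne
      simp
  · have : Measurable fun ω ↦ transition G s t (X s ω) A :=
      (Measure.measurable_coe hA).comp ((measurable_transition hG hs hst).comp (hX.measurable s))
    exact this.ennreal_toReal.aestronglyMeasurable

/-- Ray events involve `X s` and `X t` jointly, so the Markov property is needed for the pair. The
restriction to a past event `H` allows successive steps to be chained. -/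
lemma IsProcess.map_prodMk (hX : IsProcess μ ℱ G X) (hG : IsLogConvSemigroup G)
    (hs : 0 < s) (hst : s < t) {H : Set Ω} (hH : MeasurableSet[ℱ s] H) :
    (μ.restrict H).map (fun ω ↦ (X s ω, X t ω)) =
      ((μ.restrict H).map (X s)) ⊗ₘ transitionKernel hG hs hst := by
  have hmeas := (hX.measurable s).prodMk (hX.measurable t)
  have := Measure.isFiniteMeasure_map (μ.restrict H) (fun ω ↦ (X s ω, X t ω))
  refine Measure.ext_prod fun {A C} hA hC ↦ ?_
  have hk : Measurable fun x ↦ transition G s t x C :=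
    (Measure.measurable_coe hC).comp (measurable_transition hG hs hst)
  have hsA : MeasurableSet[ℱ s] (X s ⁻¹' A) := hX.adapted s hA
  rw [Measure.map_apply hmeas (hA.prod hC), Measure.compProd_apply_prod hA hC]
  simp_rw [transitionKernel_apply]
  rw [setLIntegral_map hA hk (hX.measurable s),
    Measure.restrict_restrict (hX.measurable s hA),
    hX.setLIntegral_transition hG hs hst (hsA.inter hH) hC,
    Measure.restrict_apply (hmeas (hA.prod hC))]
  congr 1
  ext ω
  simp only [mem_inter_iff, mem_preimage, mem_prod]
  tauto

lemma IsProcess.measure_inter_eq_lintegral (hX : IsProcess μ ℱ G X) (hG : IsLogConvSemigroup G)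
    (hs : 0 < s) (hst : s < t) {H : Set Ω} (hH : MeasurableSet[ℱ s] H) {B : Set (ℝ × ℝ)}
    (hB : MeasurableSet B) :
    μ ({ω | (X s ω, X t ω) ∈ B} ∩ H) =
      ∫⁻ ω in H, transition G s t (X s ω) (Prod.mk (X s ω) ⁻¹' B) ∂μ := by
  have hmeas := (hX.measurable s).prodMk (hX.measurable t)
  have h := Measure.ext_iff.mp (hX.map_prodMk hG hs hst hH) B hB
  rw [Measure.map_apply hmeas hB, Measure.restrict_apply (hmeas hB), Measure.compProd_apply hB,
    lintegral_map (Kernel.measurable_kernel_prodMk_left hB) (hX.measurable s)] at h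
  exact h

lemma IsProcess.measure_onRay_inter (hX : IsProcess μ ℱ G X) (hG : IsLogConvSemigroup G)
    (hs : 0 < s) (hst : s < t) {H : Set Ω} (hH : MeasurableSet[ℱ s] H) :
    μ (onRay X s t ∩ H) = gam G √((t : ℝ) / s) * μ H := by
  have h := hX.measure_inter_eq_lintegral hG hs hst hH
    (B := {p | p.2 = √((t : ℝ) / s) * p.1}) (measurableSet_eq_fun (by fun_prop) (by fun_prop))
  refine h.trans ?_
  rw [← setLIntegral_const]
  exact lintegral_congr fun ω ↦ transition_apply_singleton hs (X s ω)

lemma IsProcess.measure_onRay (hX : IsProcess μ ℱ G X) (hG : IsLogConvSemigroup G)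
    (hs : 0 < s) (hst : s < t) : μ (onRay X s t) = gam G √((t : ℝ) / s) := by
  simpa using hX.measure_onRay_inter hG hs hst (H := univ) .univ

lemma IsProcess.measure_near_diff_onRay_le (hX : IsProcess μ ℱ G X) (hG : IsLogConvSemigroup G)
    (hs : 0 < s) (hst : s < t) {u : ℝ≥0} (hu : 0 < u) (hut : u ≤ t) {δ : ℝ} (hδ : 0 ≤ δ) :
    μ ({ω | |X t ω - √((t : ℝ) / s) * X s ω| ≤ δ} \ onRay X s t) ≤
      ∫⁻ r in Ico (0 : ℝ) 1, smallBallBound u δ r ∂(G √((t : ℝ) / s)) := by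
  have hB : MeasurableSet ({p : ℝ × ℝ | |p.2 - √((t : ℝ) / s) * p.1| ≤ δ} \
      {p | p.2 = √((t : ℝ) / s) * p.1}) :=
    (measurableSet_le (by fun_prop) (by fun_prop)).diff
      (measurableSet_eq_fun (by fun_prop) (by fun_prop))
  have h := hX.measure_inter_eq_lintegral hG hs hst (H := univ) .univ hB
  rw [inter_univ] at h
  refine h.trans_le ?_
  calc _ ≤ ∫⁻ _ in univ, (∫⁻ r in Ico (0 : ℝ) 1, smallBallBound u δ r ∂(G √((t : ℝ) / s))) ∂μ :=
        lintegral_mono fun ω ↦ transition_closedBall_diff_le hG hs hst hu hut (X s ω) hδ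
    _ = _ := by simp

lemma sqrt_div_mul_sqrt_div {s u : ℝ≥0} (hs : 0 < s) (hu : 0 < u) (t : ℝ≥0) :
    √((u : ℝ) / s) * √((t : ℝ) / u) = √((t : ℝ) / s) := by
  rw [← Real.sqrt_mul (by positivity)]
  congr 1
  field_simp

lemma onRay_inter_subset {u : ℝ≥0} (hs : 0 < s) (hu : 0 < u) :
    onRay X u t ∩ onRay X s u ⊆ onRay X s t := by
  rintro ω ⟨h1, h2⟩
  change X t ω = _ * X s ω
  rw [← sqrt_div_mul_sqrt_div hs hu t, h1, h2]
  ring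

/-- Following the ray through u is contained in being on it at t, and by multiplicativity of γ both
events have the same probability, so they agree almost surely. -/
lemma IsProcess.onRay_ae_le (hX : IsProcess μ ℱ G X) (hG : IsLogConvSemigroup G)
    (hs : 0 < s) {u : ℝ≥0} (hsu : s < u) (hut : u < t) :
    onRay X s t ≤ᵐ[μ] onRay X s u := by
  have hu := hs.trans hsu
  have h : μ (onRay X u t ∩ onRay X s u) = μ (onRay X s t) := by
    rw [hX.measure_onRay_inter hG hu hut (hX.measurableSet_onRay_filtration hsu.le),
      hX.measure_onRay hG hs hsu, hX.measure_onRay hG hs (hsu.trans hut), mul_comm,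
      ← hG.gam_mul (one_le_sqrt_div hs hsu.le) (one_le_sqrt_div hu hut.le),
      sqrt_div_mul_sqrt_div hs hu]
  have h2 := ae_eq_of_subset_of_measure_ge (onRay_inter_subset hs hu) h.ge
    (hX.measurableSet_onRay.inter hX.measurableSet_onRay).nullMeasurableSet (measure_ne_top _ _)
  exact h2.symm.le.trans (LE.le.eventuallyLE inter_subset_right)

end Markov

/-! ### Deterministic properties of càdlàg paths -/

section Path

variable {x : ℝ≥0 → ℝ} {s t : ℝ≥0}

lemma firstJumpTime_le {v : ℝ≥0} (hsv : s < v) (hv : JumpsAt x v) : firstJumpTime x s ≤ v :=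
  sInf_le ⟨v, hsv, hv, rfl⟩

lemma le_firstJumpTime {a : ℝ≥0∞} (h : ∀ v : ℝ≥0, s < v → JumpsAt x v → a ≤ v) :
    a ≤ firstJumpTime x s := by
  refine le_sInf ?_
  rintro _ ⟨v, hsv, hv, rfl⟩
  exact h v hsv hv

lemma self_le_firstJumpTime : (s : ℝ≥0∞) ≤ firstJumpTime x s :=
  le_firstJumpTime fun _ hv _ ↦ by exact_mod_cast hv.le

/-- Right-continuity extends the agreement with `c` from `D` to all of (s, t), and a path equal to a
continuous curve there has the matching left limits. A jump at `t` itself is not excluded. -/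
lemma IsCadlag.le_firstJumpTime_of_dense (hx : IsCadlag x) {D : Set ℝ≥0} (hD : Dense D)
    {c : ℝ≥0 → ℝ} (hc : Continuous c) (h : ∀ q ∈ D, s < q → q < t → x q = c q) :
    (t : ℝ≥0∞) ≤ firstJumpTime x s := by
  have heq : ∀ u, s < u → u < t → x u = c u := by
    intro u hsu hut
    have h1 : Tendsto x (𝓝[>] u) (𝓝 (x u)) :=
      (hx u).1.tendsto.mono_left (nhdsWithin_mono _ Ioi_subset_Ici_self)
    have h2 : Tendsto c (𝓝[>] u) (𝓝 (c u)) := hc.continuousWithinAt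
    refine tendsto_nhds_unique_of_frequently_eq h1 h2 (frequently_iff.mpr fun {U} hU ↦ ?_)
    obtain ⟨b, hb, hbU⟩ := (mem_nhdsGT_iff_exists_Ioo_subset' hut).mp hU
    obtain ⟨q, hqD, hq1, hq2⟩ := hD.exists_between (lt_min hut hb)
    exact ⟨q, hbU ⟨hq1, hq2.trans_le (min_le_right _ _)⟩,
      h q hqD (hsu.trans hq1) (hq2.trans_le (min_le_left _ _))⟩
  refine le_firstJumpTime fun v hsv hv ↦ ?_
  by_contra! hvt
  have hvt' : v < t := by exact_mod_cast hvt
  obtain ⟨l, hl, hne⟩ := hv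
  have : (𝓝[<] v).NeBot := nhdsLT_neBot_of_exists_lt ⟨s, hsv⟩
  refine hne ?_
  rw [heq v hsv hvt']
  refine tendsto_nhds_unique hl (hc.continuousWithinAt.tendsto.congr' ?_)
  filter_upwards [Ioo_mem_nhdsLT hsv] with u hu
  exact (heq u hu.1 (hu.2.trans hvt')).symm

lemma IsCadlag.continuousOn_of_lt_firstJumpTime (hx : IsCadlag x)
    (ht : (t : ℝ≥0∞) < firstJumpTime x s) : ContinuousOn x (Icc s t) := by
  intro u hu
  rcases hu.1.eq_or_lt with rfl | hsu
  · exact (hx s).1.mono Icc_subset_Ici_self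
  · refine ContinuousAt.continuousWithinAt ?_
    obtain ⟨l, hl⟩ := (hx u).2
    have hlx : l = x u := by
      by_contra hne
      have h1 : firstJumpTime x s ≤ t :=
        (firstJumpTime_le hsu ⟨l, hl, hne⟩).trans (by exact_mod_cast hu.2)
      exact absurd ht h1.not_gt
    rw [continuousAt_iff_continuous_left'_right']
    rw [hlx] at hl
    exact ⟨hl, (hx u).1.mono Ioi_subset_Ici_self⟩

lemma exists_dist_lt_abs_sub_le (hs : 0 < s) (hx : ContinuousOn x (Icc s t)) {δ : ℝ}
    (hδ : 0 < δ) :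
    ∃ η > 0, ∀ u ∈ Icc s t, ∀ v ∈ Icc s t, dist u v < η → |x v - √((v : ℝ) / u) * x u| ≤ δ := by
  -- Lying on a ray means that `x u / √u` is constant, so deviations from rays are controlled by the
  -- uniform continuity of this quotient.
  have hg : ContinuousOn (fun u : ℝ≥0 ↦ x u / √(u : ℝ)) (Icc s t) := by
    refine hx.div (by fun_prop) fun u hu ↦ ?_
    have : 0 < (u : ℝ) := by exact_mod_cast hs.trans_le hu.1
    positivity
  have hu := isCompact_Icc.uniformContinuousOn_of_continuous hg
  rw [Metric.uniformContinuousOn_iff] at hu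
  obtain ⟨η, hη, h⟩ := hu (δ / (√(t : ℝ) + 1)) (by positivity)
  refine ⟨η, hη, fun u hu v hv huv ↦ ?_⟩
  have hu0 : 0 < (u : ℝ) := by exact_mod_cast hs.trans_le hu.1
  have hv0 : 0 < (v : ℝ) := by exact_mod_cast hs.trans_le hv.1
  have h1 := (h u hu v hv huv).le
  rw [dist_comm, Real.dist_eq] at h1
  have h2 : x v - √((v : ℝ) / u) * x u = √(v : ℝ) * (x v / √(v : ℝ) - x u / √(u : ℝ)) := by
    rw [Real.sqrt_div hv0.le]
    have := (Real.sqrt_pos.mpr hu0).ne'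
    have := (Real.sqrt_pos.mpr hv0).ne'
    field_simp
  have h3 : √(v : ℝ) ≤ √(t : ℝ) + 1 := by
    have : √(v : ℝ) ≤ √(t : ℝ) := Real.sqrt_le_sqrt (by exact_mod_cast hv.2)
    linarith
  rw [h2, abs_mul, abs_of_nonneg (Real.sqrt_nonneg _)]
  calc _ ≤ (√(t : ℝ) + 1) * (δ / (√(t : ℝ) + 1)) := by gcongr
    _ = δ := by field_simp

end Path

/-! ### Geometric partitions, whose steps all have the same ratio -/

section Partition

variable {s t : ℝ≥0}

/-- The ratio of consecutive points of the geometric partition of `[s, t]` into `n` pieces. -/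
noncomputable def ratio (s t : ℝ≥0) (n : ℕ) : ℝ≥0 := (t / s) ^ ((n : ℝ)⁻¹)

/-- The points of the geometric partition of `[s, t]` into `n` pieces. -/
noncomputable def node (s t : ℝ≥0) (n i : ℕ) : ℝ≥0 := s * ratio s t n ^ i

lemma ratio_pow {n : ℕ} (hn : n ≠ 0) : ratio s t n ^ n = t / s := by
  rw [ratio, ← NNReal.rpow_natCast, ← NNReal.rpow_mul, inv_mul_cancel₀ (by exact_mod_cast hn),
    NNReal.rpow_one]

lemma one_lt_ratio (hs : 0 < s) (hst : s < t) {n : ℕ} (hn : n ≠ 0) : 1 < ratio s t n := by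
  refine NNReal.one_lt_rpow ((one_lt_div hs).mpr hst) ?_
  positivity

lemma tendsto_ratio (hs : 0 < s) (ht : 0 < t) : Tendsto (ratio s t) atTop (𝓝 1) := by
  have h : Tendsto (fun y : ℝ ↦ (t / s) ^ y) (𝓝 0) (𝓝 ((t / s) ^ (0 : ℝ))) :=
    tendsto_const_nhds.nnrpow tendsto_id (.inl (div_pos ht hs).ne')
  rw [NNReal.rpow_zero] at h
  exact h.comp (tendsto_inv_atTop_nhds_zero_nat (𝕜 := ℝ))

lemma node_zero (n : ℕ) : node s t n 0 = s := by simp [node]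

lemma node_self (hs : 0 < s) {n : ℕ} (hn : n ≠ 0) : node s t n n = t := by
  rw [node, ratio_pow hn, mul_div_cancel₀ _ hs.ne']

lemma node_succ (n i : ℕ) : node s t n (i + 1) = node s t n i * ratio s t n := by
  rw [node, node, pow_succ, mul_assoc]

lemma node_mono (hs : 0 < s) (hst : s < t) {n : ℕ} (hn : n ≠ 0) : StrictMono (node s t n) := by
  refine strictMono_nat_of_lt_succ fun i ↦ ?_
  have h := one_lt_ratio hs hst hn
  have h0 : 0 < node s t n i := mul_pos hs (pow_pos (zero_lt_one.trans h) i)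
  rw [node_succ]
  exact lt_mul_of_one_lt_right h0 h

lemma node_mem (hs : 0 < s) (hst : s < t) {n i : ℕ} (hn : n ≠ 0) (hi : i ≤ n) :
    node s t n i ∈ Icc s t := by
  have h := (node_mono hs hst hn).monotone
  exact ⟨(node_zero n).symm.trans_le (h i.zero_le), (h hi).trans_eq (node_self hs hn)⟩

lemma node_succ_div (hs : 0 < s) (hst : s < t) {n : ℕ} (hn : n ≠ 0) (i : ℕ) :
    (node s t n (i + 1) : ℝ) / node s t n i = ratio s t n := by
  have h0 : 0 < node s t n i := mul_pos hs (pow_pos (zero_lt_one.trans (one_lt_ratio hs hst hn)) i)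
  rw [node_succ, NNReal.coe_mul, mul_div_cancel_left₀]
  exact_mod_cast h0.ne'

lemma one_le_sqrt_ratio (hs : 0 < s) (hst : s < t) {n : ℕ} (hn : n ≠ 0) :
    1 ≤ √(ratio s t n : ℝ) :=
  Real.one_le_sqrt.mpr (by exact_mod_cast (one_lt_ratio hs hst hn).le)

lemma sqrt_ratio_pow {n : ℕ} (hn : n ≠ 0) : √(ratio s t n : ℝ) ^ n = √((t : ℝ) / s) := by
  rw [eq_comm, Real.sqrt_eq_iff_mul_self_eq (by positivity) (by positivity), ← mul_pow,
    Real.mul_self_sqrt (by positivity), ← NNReal.coe_pow, ratio_pow hn, NNReal.coe_div]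

lemma eventually_dist_node_lt (hs : 0 < s) (hst : s < t) {η : ℝ} (hη : 0 < η) :
    ∀ᶠ n in atTop, ∀ i < n, dist (node s t n i) (node s t n (i + 1)) < η := by
  have h : Tendsto (fun n ↦ (t : ℝ) * ((ratio s t n : ℝ) - 1)) atTop (𝓝 (t * ((1 : ℝ≥0) - 1))) :=
    (((NNReal.continuous_coe.tendsto _).comp (tendsto_ratio hs (hs.trans hst))).sub_const
      1).const_mul _
  rw [NNReal.coe_one, sub_self, mul_zero] at h
  filter_upwards [h.eventually_lt_const hη, eventually_ne_atTop 0] with n hn hn0 i hi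
  have h1 := one_lt_ratio hs hst hn0
  have h2 : (1 : ℝ) < ratio s t n := by exact_mod_cast h1
  have h3 : (node s t n i : ℝ) ≤ t := by exact_mod_cast (node_mem hs hst hn0 hi.le).2
  refine lt_of_le_of_lt ?_ hn
  rw [dist_comm, NNReal.dist_eq, node_succ, NNReal.coe_mul, abs_of_nonneg]
  · nlinarith
  · nlinarith [(node s t n i).coe_nonneg]

end Partition

/-! ### Law of the first jump time -/

section FirstJump

variable {Ω : Type*} {mΩ : MeasurableSpace Ω} {μ : Measure Ω} {ℱ : Filtration ℝ≥0 mΩ}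
  {G : ℝ → Measure ℝ} {X : ℝ≥0 → Ω → ℝ} {s t : ℝ≥0}

lemma mem_onRay_of_forall_node (hs : 0 < s) (hst : s < t) {n : ℕ} (hn : n ≠ 0) {ω : Ω}
    (h : ∀ i < n, ω ∈ onRay X (node s t n i) (node s t n (i + 1))) : ω ∈ onRay X s t := by
  have hi : ∀ i ≤ n, ω ∈ onRay X s (node s t n i) := by
    intro i
    induction i with
    | zero => intro _; simp [onRay, node_zero, hs.ne']
    | succ i ih =>
      intro hin
      exact onRay_inter_subset hs (hs.trans_le (node_mem hs hst hn (by omega)).1)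
        ⟨h i (by omega), ih (by omega)⟩
  simpa [node_self hs hn] using hi n le_rfl

/-- The event that on the `n`-th geometric partition of `[s, t]` no increment deviates by more than
`δ` from the deterministic curve. -/
def nearRay (X : ℝ≥0 → Ω → ℝ) (s t : ℝ≥0) (δ : ℝ) (n : ℕ) : Set Ω :=
  {ω | ∀ i < n, |X (node s t n (i + 1)) ω -
    √((node s t n (i + 1) : ℝ) / node s t n i) * X (node s t n i) ω| ≤ δ}

lemma eventually_mem_nearRay (hs : 0 < s) (hst : s < t) {ω : Ω} (hω : IsCadlag fun u ↦ X u ω)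
    (hT : (t : ℝ≥0∞) < firstJumpTime (fun u ↦ X u ω) s) {δ : ℝ} (hδ : 0 < δ) :
    ∀ᶠ n in atTop, ω ∈ nearRay X s t δ n := by
  obtain ⟨η, hη, h⟩ := exists_dist_lt_abs_sub_le hs (hω.continuousOn_of_lt_firstJumpTime hT) hδ
  filter_upwards [eventually_dist_node_lt hs hst hη, eventually_ne_atTop 0] with n hn hn0 i hi
  exact h _ (node_mem hs hst hn0 hi.le) _ (node_mem hs hst hn0 hi) (hn i hi)

variable [IsProbabilityMeasure μ]

/-- Off the ray at `t`, some step must leave its own ray. All steps share the law `G √(ratio s t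
n)`, whose n-th power in the semi-group is `G √(t/s)`, so the union bound is dominated independently
of `n`. -/
lemma IsProcess.gam_mul_measure_nearRay_diff_le (hX : IsProcess μ ℱ G X)
    (hG : IsLogConvSemigroup G) (hs : 0 < s) (hst : s < t) {δ : ℝ} (hδ : 0 ≤ δ) {n : ℕ}
    (hn : n ≠ 0) :
    gam G √((t : ℝ) / s) * μ (nearRay X s t δ n \ onRay X s t) ≤
      ∫⁻ r in Ico (0 : ℝ) 1, smallBallBound s δ r ∂(G √((t : ℝ) / s)) := by
  have hsub : nearRay X s t δ n \ onRay X s t ⊆ ⋃ i ∈ Finset.range n,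
      ({ω | |X (node s t n (i + 1)) ω -
        √((node s t n (i + 1) : ℝ) / node s t n i) * X (node s t n i) ω| ≤ δ} \
          onRay X (node s t n i) (node s t n (i + 1))) := by
    rintro ω ⟨h1, h2⟩
    by_contra! h3
    refine h2 (mem_onRay_of_forall_node hs hst hn fun i hi ↦ ?_)
    by_contra h4
    exact h3 (mem_biUnion (Finset.mem_coe.mpr (Finset.mem_range.mpr hi)) ⟨h1 i hi, h4⟩)
  have hle : μ (nearRay X s t δ n \ onRay X s t) ≤
      n * ∫⁻ r in Ico (0 : ℝ) 1, smallBallBound s δ r ∂(G √(ratio s t n : ℝ)) := by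
    refine (measure_mono hsub).trans ((measure_biUnion_finset_le _ _).trans ?_)
    refine (Finset.sum_le_card_nsmul _ _
      (∫⁻ r in Ico (0 : ℝ) 1, smallBallBound s δ r ∂(G √(ratio s t n : ℝ))) fun i hi ↦ ?_).trans ?_
    · have hi' : i < n := Finset.mem_range.mp hi
      have h := hX.measure_near_diff_onRay_le hG
        (hs.trans_le (node_mem hs hst hn hi'.le).1) (node_mono hs hst hn i.lt_succ_self) hs
        (node_mem hs hst hn hi').1 hδ
      exact h.trans_eq (by rw [node_succ_div hs hst hn])
    · simp
  calc _ ≤ gam G √((t : ℝ) / s) *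
        (n * ∫⁻ r in Ico (0 : ℝ) 1, smallBallBound s δ r ∂(G √(ratio s t n : ℝ))) := by gcongr
    _ = n * gam G (√(ratio s t n : ℝ) ^ n) *
        ∫⁻ r in Ico (0 : ℝ) 1, smallBallBound s δ r ∂(G √(ratio s t n : ℝ)) := by
      rw [sqrt_ratio_pow hn]; ring
    _ ≤ ∫⁻ r in Ico (0 : ℝ) 1, smallBallBound s δ r ∂(G (√(ratio s t n : ℝ) ^ n)) :=
      hG.nsmul_setLIntegral_le (one_le_sqrt_ratio hs hst hn) n _
    _ = _ := by rw [sqrt_ratio_pow hn]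

lemma IsProcess.gam_mul_measure_eventually_nearRay_diff_le (hX : IsProcess μ ℱ G X)
    (hG : IsLogConvSemigroup G) (hs : 0 < s) (hst : s < t) {δ : ℝ} (hδ : 0 ≤ δ) :
    gam G √((t : ℝ) / s) * μ ({ω | ∀ᶠ n in atTop, ω ∈ nearRay X s t δ n} \ onRay X s t) ≤
      ∫⁻ r in Ico (0 : ℝ) 1, smallBallBound s δ r ∂(G √((t : ℝ) / s)) := by
  have heq : {ω | ∀ᶠ n in atTop, ω ∈ nearRay X s t δ n} \ onRay X s t =
      ⋃ N, ((⋂ n ≥ N, nearRay X s t δ n) \ onRay X s t) := by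
    rw [← iUnion_sdiff]
    congr 1
    ext ω
    simp [eventually_atTop]
  have hmono : Monotone fun N ↦ (⋂ n ≥ N, nearRay X s t δ n) \ onRay X s t := fun N M hNM ↦
    sdiff_subset_sdiff_left (biInter_subset_biInter_left fun n hn ↦ hNM.trans hn)
  rw [heq, hmono.measure_iUnion, ENNReal.mul_iSup]
  refine iSup_le fun N ↦ ?_
  -- The index `N + 1` is used because the estimate requires a nonempty partition.
  refine le_trans ?_ (hX.gam_mul_measure_nearRay_diff_le hG hs hst hδ N.succ_ne_zero)
  gcongr
  exact biInter_subset_of_mem (Nat.le_succ N)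

lemma IsProcess.ae_mem_onRay_of_lt_firstJumpTime (hX : IsProcess μ ℱ G X)
    (hG : IsLogConvSemigroup G) (hs : 0 < s) (hst : s < t) (hpos : 0 < gam G √((t : ℝ) / s)) :
    ∀ᵐ ω ∂μ, (t : ℝ≥0∞) < firstJumpTime (fun u ↦ X u ω) s → ω ∈ onRay X s t := by
  -- The first jump time is not yet known to be measurable, so only monotonicity of `μ` is applied
  -- to this set.
  have hzero : μ ({ω | IsCadlag (fun u ↦ X u ω) ∧ (t : ℝ≥0∞) < firstJumpTime (fun u ↦ X u ω) s} \
      onRay X s t) = 0 := by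
    suffices h : gam G √((t : ℝ) / s) * μ ({ω | IsCadlag (fun u ↦ X u ω) ∧
        (t : ℝ≥0∞) < firstJumpTime (fun u ↦ X u ω) s} \ onRay X s t) ≤ 0 by
      exact (mul_eq_zero.mp (le_antisymm h zero_le)).resolve_left hpos.ne'
    refine ge_of_tendsto (tendsto_lintegral_smallBallBound hG (one_le_sqrt_div hs hst.le) s) ?_
    filter_upwards [self_mem_nhdsWithin] with δ hδ
    refine le_trans ?_ (hX.gam_mul_measure_eventually_nearRay_diff_le hG hs hst (le_of_lt hδ))
    gcongr
    rintro ⟨h1, h2⟩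
    exact eventually_mem_nearRay hs hst h1 h2 hδ
  filter_upwards [hX.cadlag, measure_eq_zero_iff_ae_notMem.mp hzero] with ω h1 h2 h3
  by_contra h4
  exact h2 ⟨⟨h1, h3⟩, h4⟩

lemma IsProcess.ae_le_firstJumpTime_of_mem_onRay (hX : IsProcess μ ℱ G X)
    (hG : IsLogConvSemigroup G) (hs : 0 < s) :
    ∀ᵐ ω ∂μ, ω ∈ onRay X s t → (t : ℝ≥0∞) ≤ firstJumpTime (fun u ↦ X u ω) s := by
  obtain ⟨D, hDc, hD⟩ := TopologicalSpace.exists_countable_dense ℝ≥0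
  have h : ∀ᵐ ω ∂μ, ∀ q ∈ D, s < q → q < t → ω ∈ onRay X s t → ω ∈ onRay X s q :=
    (ae_ball_iff hDc).mpr fun q _ ↦ by
      by_cases hq : s < q ∧ q < t
      · filter_upwards [hX.onRay_ae_le hG hs hq.1 hq.2] with ω hω _ _ using hω
      · exact .of_forall fun ω h1 h2 ↦ absurd ⟨h1, h2⟩ hq
  filter_upwards [hX.cadlag, h] with ω h1 h2 h3
  refine h1.le_firstJumpTime_of_dense hD (c := fun u ↦ √((u : ℝ) / s) * X s ω) (by fun_prop)
    fun q hq hsq hqt ↦ h2 q hq hsq hqt h3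

/-- Almost surely the first jump time is the supremum of `s` and of the times in a countable dense
set at which the path is still on the ray from `s`. -/
lemma IsProcess.aemeasurable_firstJumpTime (hX : IsProcess μ ℱ G X)
    (hG : IsLogConvSemigroup G) (hpos : ∀ σ, 1 ≤ σ → 0 < gam G σ) (hs : 0 < s) :
    AEMeasurable (fun ω ↦ firstJumpTime (fun u ↦ X u ω) s) μ := by
  obtain ⟨D, hDc, hD⟩ := TopologicalSpace.exists_countable_dense ℝ≥0
  have h1 : ∀ᵐ ω ∂μ, ∀ q ∈ D, s < q →
      (q : ℝ≥0∞) < firstJumpTime (fun u ↦ X u ω) s → ω ∈ onRay X s q :=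
    (ae_ball_iff hDc).mpr fun q _ ↦ by
      by_cases hq : s < q
      · filter_upwards [hX.ae_mem_onRay_of_lt_firstJumpTime hG hs hq
          (hpos _ (one_le_sqrt_div hs hq.le))] with ω hω _ using hω
      · exact .of_forall fun ω h ↦ absurd h hq
  have h2 : ∀ᵐ ω ∂μ, ∀ q ∈ D, ω ∈ onRay X s q →
      (q : ℝ≥0∞) ≤ firstJumpTime (fun u ↦ X u ω) s :=
    (ae_ball_iff hDc).mpr fun q _ ↦ hX.ae_le_firstJumpTime_of_mem_onRay hG hs
  refine ⟨fun ω ↦ (s : ℝ≥0∞) ⊔ ⨆ q ∈ D, (onRay X s q).indicator (fun _ ↦ (q : ℝ≥0∞)) ω, ?_, ?_⟩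
  · have hm : ∀ q ∈ D, Measurable ((onRay X s q).indicator fun _ ↦ (q : ℝ≥0∞)) := fun q _ ↦
      measurable_const.indicator hX.measurableSet_onRay
    exact measurable_const.sup (.biSup D hDc hm)
  · filter_upwards [h1, h2] with ω h1 h2
    refine le_antisymm (le_of_not_gt fun hlt ↦ ?_) (sup_le self_le_firstJumpTime ?_)
    · obtain ⟨a, ha1, ha2⟩ := ENNReal.lt_iff_exists_nnreal_btwn.mp hlt
      obtain ⟨b, hb1, hb2⟩ := ENNReal.lt_iff_exists_nnreal_btwn.mp ha2
      obtain ⟨q, hqD, hq1, hq2⟩ := hD.exists_between (ENNReal.coe_lt_coe.mp hb1)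
      have hq1' := ha1.trans (ENNReal.coe_lt_coe.mpr hq1)
      have hsq : s < q := ENNReal.coe_lt_coe.mp (le_sup_left.trans_lt hq1')
      have hmem := h1 q hqD hsq ((ENNReal.coe_lt_coe.mpr hq2).trans hb2)
      refine hq1'.not_ge (le_sup_of_le_right (le_iSup₂_of_le q hqD ?_))
      rw [indicator_of_mem hmem]
    · refine iSup₂_le fun q hq ↦ ?_
      by_cases hmem : ω ∈ onRay X s q
      · rw [indicator_of_mem hmem]
        exact h2 q hq hmem
      · rw [indicator_of_notMem hmem]
        exact zero_le

/-- The n-th power of γ at the step ratio is the fixed positive number γ(√(t/s)), which could not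
survive if every step value were at most `b < 1`. -/
lemma IsLogConvSemigroup.exists_lt_gam_ratio (hG : IsLogConvSemigroup G)
    (hpos : ∀ σ, 1 ≤ σ → 0 < gam G σ) (hs : 0 < s) (hst : s < t) {b : ℝ≥0∞} (hb : b < 1) :
    ∃ n ≠ 0, b < gam G √(ratio s t n : ℝ) := by
  by_contra! h
  have hle : ∀ᶠ n : ℕ in atTop, gam G √((t : ℝ) / s) ≤ b ^ n := by
    filter_upwards [eventually_ne_atTop 0] with n hn
    rw [← sqrt_ratio_pow hn, hG.gam_pow (hpos 1 le_rfl) (one_le_sqrt_ratio hs hst hn)]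
    gcongr
    exact h n hn
  have h0 := ge_of_tendsto (ENNReal.tendsto_pow_atTop_nhds_zero_of_lt_one hb) hle
  exact (hpos _ (one_le_sqrt_div hs hst.le)).not_ge h0

lemma IsProcess.measure_lt_firstJumpTime (hX : IsProcess μ ℱ G X)
    (hG : IsLogConvSemigroup G) (hpos : ∀ σ, 1 ≤ σ → 0 < gam G σ) (hs : 0 < s) (hst : s ≤ t) :
    μ {ω | (t : ℝ≥0∞) < firstJumpTime (fun u ↦ X u ω) s} = gam G √((t : ℝ) / s) := by
  have ht := hs.trans_le hst
  refine le_antisymm ?_ (ENNReal.le_of_forall_lt_one_mul_le fun b hb ↦ ?_)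
  · rcases hst.eq_or_lt with rfl | hlt
    · rw [div_self (by exact_mod_cast hs.ne'), Real.sqrt_one, hG.gam_one (hpos 1 le_rfl)]
      exact prob_le_one
    · rw [← hX.measure_onRay hG hs hlt]
      exact measure_mono_ae (hX.ae_mem_onRay_of_lt_firstJumpTime hG hs hlt
        (hpos _ (one_le_sqrt_div hs hst)))
  -- To obtain the strict inequality, the ray is followed to a time `t * ρ` slightly beyond `t`, at
  -- the cost of a factor γ(√ρ) > b. The endpoint `t + t` only serves to produce ratios close to 1.
  · obtain ⟨n, hn, hbn⟩ := hG.exists_lt_gam_ratio hpos ht (lt_add_of_pos_right t ht) hb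
    have hr := one_lt_ratio ht (lt_add_of_pos_right t ht) hn
    set ρ := ratio t (t + t) n
    have htt : t < t * ρ := lt_mul_of_one_lt_right ht hr
    calc b * gam G √((t : ℝ) / s) ≤ gam G √(ρ : ℝ) * gam G √((t : ℝ) / s) := by gcongr
      _ = gam G √(((t * ρ : ℝ≥0) : ℝ) / s) := by
        rw [← hG.gam_mul (Real.one_le_sqrt.mpr (by exact_mod_cast hr.le))
          (one_le_sqrt_div hs hst), ← Real.sqrt_mul ρ.coe_nonneg, NNReal.coe_mul]
        congr 2
        ring
      _ = μ (onRay X s (t * ρ)) := (hX.measure_onRay hG hs (hst.trans_lt htt)).symm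
      _ ≤ _ := by
        refine measure_mono_ae ?_
        filter_upwards [hX.ae_le_firstJumpTime_of_mem_onRay hG hs] with ω hω h
        exact (ENNReal.coe_lt_coe.mpr htt).trans_le (hω h)

end FirstJump

/-! ### The Poisson family -/

section Poisson

/-- These bounds place the constant c strictly between 2 and 4, hence the Pareto exponent c/2
between 1 and 2. -/
lemma exp_neg_half_mem : Real.exp (-1 / 2) ∈ Ioo (1 / 2 : ℝ) (3 / 4) := by
  have h : Real.exp (-1 / 2) * Real.exp (-1 / 2) * Real.exp 1 = 1 := by
    rw [← Real.exp_add, ← Real.exp_add]; norm_num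
  have h1 := Real.exp_one_gt_d9
  have h2 := Real.exp_one_lt_d9
  have h3 := Real.exp_pos (-1 / 2)
  have h4 := Real.exp_pos 1
  constructor
  · by_contra! h5
    nlinarith [mul_le_mul h5 h5 h3.le (by norm_num)]
  · by_contra! h5
    nlinarith [mul_le_mul h5 h5 (by norm_num) h3.le]

lemma two_lt_poissonConst : 2 < poissonConst := by
  obtain ⟨h1, h2⟩ := exp_neg_half_mem
  rw [poissonConst, lt_div_iff₀ (by linarith)]
  linarith

lemma poissonConst_lt_four : poissonConst < 4 := by
  obtain ⟨h1, h2⟩ := exp_neg_half_mem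
  rw [poissonConst, div_lt_iff₀ (by linarith)]
  linarith

lemma poissonConst_mul : poissonConst * (1 - Real.exp (-1 / 2)) = 1 := by
  obtain ⟨h1, h2⟩ := exp_neg_half_mem
  rw [poissonConst, div_mul_cancel₀]
  linarith

lemma poissonConst_mul_log_nonneg {σ : ℝ} (hσ : 1 ≤ σ) : 0 ≤ poissonConst * Real.log σ :=
  mul_nonneg (by linarith [two_lt_poissonConst]) (Real.log_nonneg hσ)

lemma poissonFamily_mconv {σ τ : ℝ} (hσ : 1 ≤ σ) (hτ : 1 ≤ τ) :
    Measure.mconv (poissonFamily σ) (poissonFamily τ) = poissonFamily (σ * τ) := by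
  have hsum : Real.toNNReal (poissonConst * Real.log (σ * τ)) =
      Real.toNNReal (poissonConst * Real.log σ) + Real.toNNReal (poissonConst * Real.log τ) := by
    rw [← Real.toNNReal_add (poissonConst_mul_log_nonneg hσ) (poissonConst_mul_log_nonneg hτ),
      Real.log_mul (by linarith) (by linarith), mul_add]
  rw [poissonFamily, poissonFamily, poissonFamily, hsum, ← poissonMeasure_conv_poissonMeasure,
    Measure.mconv, Measure.conv, Measure.map_prod_map _ _ .of_discrete .of_discrete,
    Measure.map_map (by fun_prop) .of_discrete, Measure.map_map .of_discrete .of_discrete]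
  congr 1
  ext p
  simp only [Function.comp_apply, Prod.map_fst, Prod.map_snd, ← Real.exp_add]
  push_cast
  congr 1
  ring

/-- This is the Poisson generating function at `e^{-1/2}`, namely `exp(-l (1 - e^{-1/2}))` with `l =
c ln σ`; c is chosen to make the exponent `-ln σ`. -/
lemma integral_sqrt_poissonFamily {σ : ℝ} (hσ : 1 ≤ σ) :
    ∫ r, √r ∂(poissonFamily σ) = 1 / σ := by
  rw [poissonFamily, integral_map .of_discrete (by fun_prop), integral_poissonMeasure,
    Real.coe_toNNReal _ (poissonConst_mul_log_nonneg hσ)]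
  set l := poissonConst * Real.log σ with hl
  have hterm : ∀ n : ℕ, (Real.exp (-l) * l ^ n / n.factorial) • √(Real.exp (-(n : ℝ))) =
      Real.exp (-l) * ((l * Real.exp (-1 / 2)) ^ n / n.factorial) := by
    intro n
    rw [← Real.exp_half, mul_pow l, ← Real.exp_nat_mul, smul_eq_mul]
    ring_nf
  simp_rw [hterm]
  rw [tsum_mul_left, (NormedSpace.expSeries_div_hasSum_exp (l * Real.exp (-1 / 2))).tsum_eq,
    ← Real.exp_eq_exp_ℝ, ← Real.exp_add]
  have h : -l + l * Real.exp (-1 / 2) = -Real.log σ := by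
    have := poissonConst_mul
    rw [hl]
    linear_combination (-Real.log σ) * this
  rw [h, Real.exp_neg, Real.exp_log (by linarith), one_div]

lemma isLogConvSemigroup_poissonFamily : IsLogConvSemigroup poissonFamily where
  isProbabilityMeasure _ _ := Measure.isProbabilityMeasure_map .of_discrete
  supported σ _ := by
    refine (ae_map_iff (p := (· ∈ Icc (0 : ℝ) 1)) .of_discrete measurableSet_Icc).mpr
      (.of_forall fun n ↦ ⟨(Real.exp_pos _).le, ?_⟩)
    rw [Real.exp_le_one_iff]
    simp
  mconv_eq _ _ hσ hτ := poissonFamily_mconv hσ hτ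
  half_moment _ hσ := integral_sqrt_poissonFamily hσ

lemma gam_poissonFamily {σ : ℝ} (hσ : 1 ≤ σ) :
    gam poissonFamily σ = ENNReal.ofReal (σ ^ (-poissonConst)) := by
  have hpre : (fun n : ℕ ↦ Real.exp (-(n : ℝ))) ⁻¹' {1} = {0} := by
    ext n
    simp
  rw [gam, poissonFamily, Measure.map_apply .of_discrete (measurableSet_singleton _), hpre,
    poissonMeasure_singleton, Real.coe_toNNReal _ (poissonConst_mul_log_nonneg hσ),
    Real.rpow_def_of_pos (by linarith)]
  simp [mul_comm]

lemma gam_poissonFamily_pos {σ : ℝ} (hσ : 1 ≤ σ) : 0 < gam poissonFamily σ := by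
  rw [gam_poissonFamily hσ, ENNReal.ofReal_pos]
  exact Real.rpow_pos_of_pos (by linarith) _

lemma gam_poissonFamily_sqrt_div {s t : ℝ≥0} (hs : 0 < s) (hst : s ≤ t) :
    gam poissonFamily √((t : ℝ) / s) =
      ENNReal.ofReal ((s : ℝ) ^ (poissonConst / 2) / (t : ℝ) ^ (poissonConst / 2)) := by
  have hs' : 0 < (s : ℝ) := hs
  have ht' : 0 < (t : ℝ) := hs.trans_le hst
  rw [gam_poissonFamily (one_le_sqrt_div hs hst), Real.sqrt_eq_rpow, ← Real.rpow_mul (by positivity),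
    ← Real.div_rpow hs'.le ht'.le, ← inv_div, Real.inv_rpow (by positivity),
    ← Real.rpow_neg (by positivity)]
  congr 2
  ring

end Poisson

/-! ### Tails and moments of the Pareto law -/

section Pareto

variable {s r : ℝ}

lemma lintegral_Ioi_ofReal_rpow {a : ℝ} (ha : a < -1) {t : ℝ} (ht : 0 < t) :
    ∫⁻ x in Ioi t, ENNReal.ofReal (x ^ a) = ENNReal.ofReal (-t ^ (a + 1) / (a + 1)) := by
  rw [← integral_Ioi_rpow_of_lt ha ht,
    ofReal_integral_eq_lintegral_ofReal (integrableOn_Ioi_rpow_of_lt ha ht)]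
  filter_upwards [ae_restrict_mem measurableSet_Ioi] with x hx
  exact Real.rpow_nonneg (ht.trans hx).le _

lemma lintegral_Ioi_ofReal_rpow_eq_top {a : ℝ} (ha : -1 ≤ a) {t : ℝ} (ht : 0 < t) :
    ∫⁻ x in Ioi t, ENNReal.ofReal (x ^ a) = ∞ := by
  by_contra h
  have hnn : 0 ≤ᵐ[volume.restrict (Ioi t)] fun x : ℝ ↦ x ^ a := by
    filter_upwards [ae_restrict_mem measurableSet_Ioi] with x hx
    exact Real.rpow_nonneg (ht.trans hx).le _
  have hi : IntegrableOn (fun x : ℝ ↦ x ^ a) (Ioi t) :=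
    (lintegral_ofReal_ne_top_iff_integrable
      (by fun_prop : Measurable fun x : ℝ ↦ x ^ a).aestronglyMeasurable hnn).mp h
  exact ((integrableOn_Ioi_rpow_iff ht).mp hi).not_ge ha

lemma setLIntegral_Ioi_ofReal_pow_paretoMeasure (hs : 0 < s) (hr : 0 < r) {t : ℝ} (hst : s ≤ t)
    (k : ℕ) :
    ∫⁻ x in Ioi t, ENNReal.ofReal x ^ k ∂(paretoMeasure s r) =
      ENNReal.ofReal (r * s ^ r) * ∫⁻ x in Ioi t, ENNReal.ofReal (x ^ (k - (r + 1))) := by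
  have hm : Measurable (paretoPDF s r) := by unfold paretoPDF; fun_prop
  rw [paretoMeasure, setLIntegral_withDensity_eq_setLIntegral_mul _ hm (by fun_prop)
    measurableSet_Ioi, ← lintegral_const_mul _ (by fun_prop)]
  refine setLIntegral_congr_fun measurableSet_Ioi fun x hx ↦ ?_
  have hsx : s ≤ x := hst.trans (le_of_lt hx)
  have hx0 : 0 < x := hs.trans_le hsx
  rw [Pi.mul_apply, paretoPDF_of_le hsx, ← ENNReal.ofReal_pow hx0.le,
    ← ENNReal.ofReal_mul (by positivity), ← ENNReal.ofReal_mul (by positivity),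
    sub_eq_add_neg, Real.rpow_add hx0, Real.rpow_natCast]
  congr 1
  ring

lemma paretoMeasure_Ioi (hs : 0 < s) (hr : 0 < r) {t : ℝ} (hst : s ≤ t) :
    paretoMeasure s r (Ioi t) = ENNReal.ofReal (s ^ r / t ^ r) := by
  have ht := hs.trans_le hst
  have h := setLIntegral_Ioi_ofReal_pow_paretoMeasure hs hr hst 0
  simp only [pow_zero, lintegral_const, one_mul, Measure.restrict_apply_univ] at h
  rw [h, lintegral_Ioi_ofReal_rpow (by push_cast; linarith) ht,
    ← ENNReal.ofReal_mul (by positivity)]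
  congr 1
  have : ((0 : ℕ) : ℝ) - (r + 1) + 1 = -r := by push_cast; ring
  rw [this, Real.rpow_neg ht.le]
  field_simp

lemma ae_lt_paretoMeasure (hs : 0 < s) (hr : 0 < r) : ∀ᵐ x ∂(paretoMeasure s r), x ∈ Ioi s := by
  have := isProbabilityMeasure_paretoMeasure hs hr
  refine (mem_ae_iff_prob_eq_one measurableSet_Ioi).mpr ?_
  rw [paretoMeasure_Ioi hs hr le_rfl, div_self (Real.rpow_pos_of_pos hs r).ne', ENNReal.ofReal_one]

lemma lintegral_ofReal_pow_paretoMeasure (hs : 0 < s) (hr : 0 < r) (k : ℕ) :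
    ∫⁻ x, ENNReal.ofReal x ^ k ∂(paretoMeasure s r) =
      ENNReal.ofReal (r * s ^ r) * ∫⁻ x in Ioi s, ENNReal.ofReal (x ^ (k - (r + 1))) := by
  rw [← setLIntegral_Ioi_ofReal_pow_paretoMeasure hs hr le_rfl,
    Measure.restrict_eq_self_of_ae_mem (ae_lt_paretoMeasure hs hr)]

lemma lintegral_ofReal_paretoMeasure (hs : 0 < s) (hr : 1 < r) :
    ∫⁻ x, ENNReal.ofReal x ∂(paretoMeasure s r) = ENNReal.ofReal (r * s / (r - 1)) := by
  have h := lintegral_ofReal_pow_paretoMeasure hs (zero_lt_one.trans hr) 1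
  simp only [pow_one] at h
  rw [h, lintegral_Ioi_ofReal_rpow (by push_cast; linarith) hs,
    ← ENNReal.ofReal_mul (by positivity)]
  congr 1
  have h1 : ((1 : ℕ) : ℝ) - (r + 1) + 1 = -(r - 1) := by push_cast; ring
  have h2 : s ^ r * s ^ (-(r - 1)) = s := by
    rw [← Real.rpow_add hs]
    simp
  rw [h1, div_neg, neg_div, neg_neg, mul_div_assoc', mul_assoc, h2]

/-- The integrand decays like `x ^ (1 - r)`, which is not integrable at infinity when `r ≤ 2`. -/
lemma lintegral_ofReal_sq_paretoMeasure (hs : 0 < s) (hr : 0 < r) (hr2 : r ≤ 2) :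
    ∫⁻ x, ENNReal.ofReal x ^ 2 ∂(paretoMeasure s r) = ∞ := by
  rw [lintegral_ofReal_pow_paretoMeasure hs hr 2,
    lintegral_Ioi_ofReal_rpow_eq_top (by push_cast; linarith) hs, ENNReal.mul_top]
  rw [ne_eq, ENNReal.ofReal_eq_zero, not_le]
  positivity

/-- Tails determine a law on `ℝ≥0∞`. Those beyond `s` suffice: the tail at `s` is already 1, so all
earlier ones are too. -/
lemma eq_map_paretoMeasure {ν : Measure ℝ≥0∞} [IsProbabilityMeasure ν] {s : ℝ≥0} (hs : 0 < s)
    (hr : 0 < r)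
    (h : ∀ t : ℝ≥0, s ≤ t → ν (Ioi (t : ℝ≥0∞)) = ENNReal.ofReal ((s : ℝ) ^ r / (t : ℝ) ^ r)) :
    ν = (paretoMeasure s r).map ENNReal.ofReal := by
  have := isProbabilityMeasure_paretoMeasure (t := s) hs hr
  have := Measure.isProbabilityMeasure_map (μ := paretoMeasure s r)
    ENNReal.measurable_ofReal.aemeasurable
  have key : ∀ t : ℝ≥0, s ≤ t →
      ν (Ioi (t : ℝ≥0∞)) = (paretoMeasure s r).map ENNReal.ofReal (Ioi (t : ℝ≥0∞)) := by
    intro t hst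
    rw [h t hst, Measure.map_apply ENNReal.measurable_ofReal measurableSet_Ioi,
      ← paretoMeasure_Ioi (NNReal.coe_pos.mpr hs) hr (NNReal.coe_le_coe.mpr hst)]
    congr 1
    ext x
    simp [ENNReal.lt_ofReal_iff_toReal_lt]
  have hone : ν (Ioi (s : ℝ≥0∞)) = 1 := by
    have : 0 < (s : ℝ) ^ r := Real.rpow_pos_of_pos hs r
    rw [h s le_rfl, div_self this.ne', ENNReal.ofReal_one]
  refine Measure.ext_of_Iic _ _ fun a ↦ ?_
  induction a with
  | top => simp
  | coe t =>
    rw [← compl_Ioi, prob_compl_eq_one_sub measurableSet_Ioi, prob_compl_eq_one_sub measurableSet_Ioi]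
    congr 1
    rcases le_total s t with hst | hts
    · exact key t hst
    · have hsub : Ioi (s : ℝ≥0∞) ⊆ Ioi (t : ℝ≥0∞) := Ioi_subset_Ioi (by exact_mod_cast hts)
      rw [le_antisymm prob_le_one (hone.symm.trans_le (measure_mono hsub)),
        le_antisymm prob_le_one ((hone.symm.trans (key s le_rfl)).trans_le (measure_mono hsub))]

end Pareto

end GaussianMarginals

theorem mainTheorem7 {Ω : Type*} {mΩ : MeasurableSpace Ω} (μ : Measure Ω)
    [IsProbabilityMeasure μ] (ℱ : Filtration ℝ≥0 mΩ) (X : ℝ≥0 → Ω → ℝ)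
    (s : ℝ≥0) (hs : 0 < s) :
    -- the general case `γ > 0`
    (∀ G : ℝ → Measure ℝ, GaussianMarginals.IsLogConvSemigroup G →
      (∀ σ, 1 ≤ σ → 0 < GaussianMarginals.gam G σ) →
      GaussianMarginals.IsProcess μ ℱ G X →
        AEMeasurable (fun ω ↦ GaussianMarginals.firstJumpTime (fun t ↦ X t ω) s) μ ∧
        ∀ t : ℝ≥0, s < t →
          μ {ω | (t : ℝ≥0∞) < GaussianMarginals.firstJumpTime (fun t ↦ X t ω) s} =
            GaussianMarginals.gam G √((t : ℝ) / s)) ∧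
    -- the Poisson family is an instance of it, with `γ(σ) = σ ^ (-c)`
    (GaussianMarginals.IsLogConvSemigroup GaussianMarginals.poissonFamily ∧
      ∀ σ : ℝ, 1 ≤ σ → GaussianMarginals.gam GaussianMarginals.poissonFamily σ =
        ENNReal.ofReal (σ ^ (-GaussianMarginals.poissonConst))) ∧
    -- the Poisson case: the first jump time is Pareto distributed
    (GaussianMarginals.IsProcess μ ℱ GaussianMarginals.poissonFamily X →
      AEMeasurable (fun ω ↦ GaussianMarginals.firstJumpTime (fun t ↦ X t ω) s) μ ∧
      (∀ t : ℝ≥0, s < t →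
        μ {ω | (t : ℝ≥0∞) < GaussianMarginals.firstJumpTime (fun t ↦ X t ω) s} =
          ENNReal.ofReal ((s : ℝ) ^ (GaussianMarginals.poissonConst / 2) /
            (t : ℝ) ^ (GaussianMarginals.poissonConst / 2))) ∧
      μ.map (fun ω ↦ GaussianMarginals.firstJumpTime (fun t ↦ X t ω) s) =
        (paretoMeasure s (GaussianMarginals.poissonConst / 2)).map ENNReal.ofReal ∧
      ∫⁻ ω, GaussianMarginals.firstJumpTime (fun t ↦ X t ω) s ∂μ =
        ENNReal.ofReal (GaussianMarginals.poissonConst * s /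
          (GaussianMarginals.poissonConst - 2)) ∧
      ∫⁻ ω, GaussianMarginals.firstJumpTime (fun t ↦ X t ω) s ^ 2 ∂μ = ∞) := by
  have poisson_process : GaussianMarginals.IsProcess μ ℱ GaussianMarginals.poissonFamily X →
      ∀ t : ℝ≥0, s ≤ t →
        μ {ω | (t : ℝ≥0∞) < GaussianMarginals.firstJumpTime (fun t ↦ X t ω) s} =
          ENNReal.ofReal ((s : ℝ) ^ (GaussianMarginals.poissonConst / 2) /
            (t : ℝ) ^ (GaussianMarginals.poissonConst / 2)) := fun hX t hst ↦ by
    rw [hX.measure_lt_firstJumpTime GaussianMarginals.isLogConvSemigroup_poissonFamily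
      (fun _ ↦ GaussianMarginals.gam_poissonFamily_pos) hs hst,
      GaussianMarginals.gam_poissonFamily_sqrt_div hs hst]
  refine ⟨fun G hG hpos hX ↦ ⟨hX.aemeasurable_firstJumpTime hG hpos hs,
      fun t hst ↦ hX.measure_lt_firstJumpTime hG hpos hs hst.le⟩,
    ⟨GaussianMarginals.isLogConvSemigroup_poissonFamily,
      fun _ ↦ GaussianMarginals.gam_poissonFamily⟩, fun hX ↦ ?_⟩
  -- The exponent c/2 exceeds 1, so the mean is finite, and is at most 2, so the second moment is
  -- infinite.
  have hc2 := GaussianMarginals.two_lt_poissonConst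
  have hc4 := GaussianMarginals.poissonConst_lt_four
  have hae := hX.aemeasurable_firstJumpTime GaussianMarginals.isLogConvSemigroup_poissonFamily
    (fun _ ↦ GaussianMarginals.gam_poissonFamily_pos) hs
  have := Measure.isProbabilityMeasure_map hae
  have hmap : μ.map (fun ω ↦ GaussianMarginals.firstJumpTime (fun t ↦ X t ω) s) =
      (paretoMeasure s (GaussianMarginals.poissonConst / 2)).map ENNReal.ofReal :=
    GaussianMarginals.eq_map_paretoMeasure hs (by linarith) fun t hst ↦ by
      rw [Measure.map_apply_of_aemeasurable hae measurableSet_Ioi]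
      exact poisson_process hX t hst
  have hlint : ∀ f : ℝ≥0∞ → ℝ≥0∞, Measurable f →
      ∫⁻ ω, f (GaussianMarginals.firstJumpTime (fun t ↦ X t ω) s) ∂μ =
        ∫⁻ x, f (ENNReal.ofReal x) ∂(paretoMeasure s (GaussianMarginals.poissonConst / 2)) := by
    intro f hf
    rw [← lintegral_map' (f := f) hf.aemeasurable hae, hmap, lintegral_map hf (by fun_prop)]
  refine ⟨hae, fun t hst ↦ poisson_process hX t hst.le, hmap, ?_, ?_⟩
  · rw [hlint (fun x ↦ x) measurable_id,
      GaussianMarginals.lintegral_ofReal_paretoMeasure (NNReal.coe_pos.mpr hs)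
        (by linarith)]
    congr 1
    have h1 : GaussianMarginals.poissonConst / 2 - 1 ≠ 0 := by linarith
    have h2 : GaussianMarginals.poissonConst - 2 ≠ 0 := by linarith
    field_simp
  · rw [hlint (fun x ↦ x ^ 2) (by fun_prop),
      GaussianMarginals.lintegral_ofReal_sq_paretoMeasure (NNReal.coe_pos.mpr hs)
        (by linarith) (by linarith)]
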